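/- Let $\mathcal F^2(\mathbb C)$ be the Fock space of entire functions $f$ with $\frac1\pi\int_{\mathbb C}|f(z)|^2e^{-|z|^2}\,dV(z)<\infty$, and let $U$ be the Segal–Bargmann transform $Uf(z)=\int_{\mathbb R}A(z,x)f(x)\,dx$, where $A(z,x)=\pi^{-1/4}e^{(-z^2+2\sqrt2\,xz-x^2)/2}$. This $U$ is a unitary operator from $L^2(\mathbb R)$ onto $\mathcal F^2(\mathbb C)$. For a tempered distribution $u$ on $\mathbb R$ put likewise $Uu(z)=\langle u,A(z,\cdot)\rangle$ (bilinear pairing), and let $Xu(x)=xu(x)$ and $Pu=-iu'$ act on tempered distributions. Let $\kappa\ge 0$ be an integer, $\alpha_{j,p}\in\mathbb C$ for $0\le j,p\le\kappa$, and $\psi_p(z)=\sum_{j=0}^{\kappa}\alpha_{j,p}z^j$. For $f\in\mathcal F^2(\mathbb C)$ let $\mathcal D[\psi]f=\sum_{p=0}^{\kappa}\psi_pf^{(p)}$, and let $T_{\max}$ be the maximal differential operator on $\mathcal F^2(\mathbb C)$: $\operatorname{dom}(T_{\max})=\{f\in\mathcal F^2(\mathbb C):\mathcal D[\psi]f\in\mathcal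 F^2(\mathbb C)\}$, $T_{\max}f=\mathcal D[\psi]f$. Let $$E=\sum_{p=0}^{\kappa}\sum_{j=0}^{\kappa}\alpha_{j,p}\Big(\frac{X-iP}{\sqrt2}\Big)^j\Big(\frac{X+iP}{\sqrt2}\Big)^p$$ and let $L_{\max}$ be the maximal differential operator on $L^2(\mathbb R)$ induced by $E$: $\operatorname{dom}(L_{\max})=\{f\in L^2(\mathbb R):Ef\in L^2(\mathbb R)\}$ with $Ef$ taken in the sense of distributions, and $L_{\max}f=Ef$. Then $$\mathcal D[\psi]=U\,E\,U^{-1}\quad\text{on }\mathcal F^2(\mathbb C),\qquad\text{i.e. } \mathcal D[\psi]f(z)=\big(U(E(U^{-1}f))\big)(z)\ \text{ for all } f\in\mathcal F^2(\mathbb C),\ z\in\mathbb C,$$ and $$T_{\max}=U\,L_{\max}\,U^{-1},$$ an equality of unbounded operators including their domains, where $\operatorname{dom}(UL_{\max}U^{-1})=\{f:U^{-1}f\in\operatorname{dom}(L_{\max})\}$. -/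

import Mathlib

open MeasureTheory
open scoped SchwartzMap ContDiff

noncomputable section

/-! ### The Fock space -/

/-- The Gaussian measure `π⁻¹ exp (-|z|²) dV(z)` on `ℂ`. -/
def fockMeasure : Measure ℂ :=
  (volume : Measure ℂ).withDensity
    (fun z => ENNReal.ofReal (Real.pi⁻¹ * Real.exp (-‖z‖ ^ 2)))

/-- The space of entire functions that are square integrable for the Gaussian measure. -/
def fockSubmodule : Submodule ℂ (ℂ → ℂ) where
  carrier := {f | Differentiable ℂ f ∧ MemLp f 2 fockMeasure}
  zero_mem' := ⟨differentiable_const 0, MemLp.zero⟩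
  add_mem' := fun hf hg => ⟨hf.1.add hg.1, hf.2.add hg.2⟩
  smul_mem' := fun c _ hf => ⟨hf.1.const_smul c, hf.2.const_smul c⟩

/-- The Fock space: entire functions, square integrable for the Gaussian measure. It is a type of
its own, so that it carries the Hilbert norm and not the topology of pointwise convergence. -/
def FockSpace : Type := fockSubmodule

namespace FockSpace

instance : AddCommGroup FockSpace := inferInstanceAs (AddCommGroup fockSubmodule)

instance : Module ℂ FockSpace := inferInstanceAs (Module ℂ fockSubmodule)

/-- The inclusion of the Fock space into the space of all functions `ℂ → ℂ`. -/
def toFunₗ : FockSpace →ₗ[ℂ] (ℂ → ℂ) := fockSubmodule.subtype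

instance : CoeFun FockSpace (fun _ => ℂ → ℂ) := ⟨fun f => toFunₗ f⟩

theorem toFunₗ_injective : Function.Injective toFunₗ := Subtype.val_injective

theorem differentiable (f : FockSpace) : Differentiable ℂ f := f.2.1

theorem memLp (f : FockSpace) : MemLp f 2 fockMeasure := f.2.2

/-- The inclusion of the Fock space into `L²` of the Gaussian measure. -/
def toLp : FockSpace →ₗ[ℂ] Lp ℂ 2 fockMeasure where
  toFun f := f.memLp.toLp f
  map_add' _ _ := rfl
  map_smul' _ _ := rfl

theorem toLp_injective : Function.Injective toLp := by
  have hac : (volume : Measure ℂ) ≪ fockMeasure := by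
    apply withDensity_absolutelyContinuous'
    · exact (by fun_prop : Measurable (fun z : ℂ =>
        ENNReal.ofReal (Real.pi⁻¹ * Real.exp (-‖z‖ ^ 2)))).aemeasurable
    · exact Filter.Eventually.of_forall fun z => by
        have : 0 < Real.pi⁻¹ * Real.exp (-‖z‖ ^ 2) := by positivity
        simpa using this
  have : fockMeasure.IsOpenPosMeasure := hac.isOpenPosMeasure
  intro f g h
  apply toFunₗ_injective
  have h' : (f : ℂ → ℂ) =ᵐ[fockMeasure] g := (MemLp.toLp_eq_toLp_iff f.memLp g.memLp).1 h
  exact (Continuous.ae_eq_iff_eq fockMeasure f.differentiable.continuous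
    g.differentiable.continuous).1 h'

instance : NormedAddCommGroup FockSpace :=
  NormedAddCommGroup.induced FockSpace (Lp ℂ 2 fockMeasure) toLp toLp_injective

/-- The inner product of the Fock space is the one of `L²` of the Gaussian measure. -/
instance : InnerProductSpace ℂ FockSpace where
  norm_smul_le c f := norm_smul_le c (toLp f)
  inner f g := inner ℂ (toLp f) (toLp g)
  norm_sq_eq_re_inner f := norm_sq_eq_re_inner (𝕜 := ℂ) (toLp f)
  conj_inner_symm f g := inner_conj_symm (toLp f) (toLp g)
  add_left f g h := inner_add_left (𝕜 := ℂ) (toLp f) (toLp g) (toLp h)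
  smul_left f g c := inner_smul_left (𝕜 := ℂ) (toLp f) (toLp g) c

/-- The inner product of the Fock space in integral form (conjugate-linear in the first slot). -/
theorem inner_eq_integral (f g : FockSpace) :
    inner ℂ f g = (Real.pi : ℂ)⁻¹ *
      ∫ z : ℂ, g z * (starRingEnd ℂ) (f z) * Complex.exp (-(‖z‖ : ℂ) ^ 2) := by
  have h1 : inner ℂ f g = inner ℂ (toLp f) (toLp g) := rfl
  rw [h1, L2.inner_def]
  have h2 : ∫ z, inner ℂ (toLp f z) (toLp g z) ∂fockMeasure
      = ∫ z, g z * (starRingEnd ℂ) (f z) ∂fockMeasure := by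
    apply integral_congr_ae
    filter_upwards [f.memLp.coeFn_toLp, g.memLp.coeFn_toLp] with z hf hg
    change inner ℂ ((f.memLp.toLp f) z) ((g.memLp.toLp g) z) = _
    rw [hf, hg]
    simp [RCLike.inner_apply]
  rw [h2, fockMeasure, integral_withDensity_eq_integral_toReal_smul (by fun_prop) (by simp),
    ← integral_const_mul]
  congr 1
  ext z
  rw [ENNReal.toReal_ofReal (by positivity), Complex.real_smul]
  push_cast
  ring

end FockSpace

/-! ### Maximal differential operators on the Fock space -/

/-- The differential expression `𝒟[ψ] f = ∑_{p ≤ κ} ψ_p f^{(p)}` on the Fock space; the result is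
a function on `ℂ`, in general not in the Fock space. -/
def fockDiffExpr (κ : ℕ) (ψ : ℕ → ℂ → ℂ) : FockSpace →ₗ[ℂ] (ℂ → ℂ) where
  toFun f := fun z => ∑ p ∈ Finset.range (κ + 1), ψ p z * iteratedDeriv p f z
  map_add' f g := by
    ext z
    have h : ∀ p : ℕ, iteratedDeriv p (FockSpace.toFunₗ f + FockSpace.toFunₗ g) z
        = iteratedDeriv p f z + iteratedDeriv p g z := fun p =>
      iteratedDeriv_add f.differentiable.contDiff.contDiffAt g.differentiable.contDiff.contDiffAt
    simp only [map_add, h, mul_add, Finset.sum_add_distrib, Pi.add_apply]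
  map_smul' c f := by
    ext z
    have h : ∀ p : ℕ, iteratedDeriv p (c • FockSpace.toFunₗ f) z = c • iteratedDeriv p f z :=
      fun p => iteratedDeriv_const_smul f.differentiable.contDiff.contDiffAt c
    simp only [map_smul, h, smul_eq_mul, Pi.smul_apply, RingHom.id_apply, Finset.mul_sum]
    exact Finset.sum_congr rfl fun p _ => by ring

/-- The maximal differential operator `T_max` on the Fock space: its domain consists of all `f` in
the Fock space such that `𝒟[ψ] f` is in the Fock space, and `T_max f = 𝒟[ψ] f`. -/
def fockMaxOp (κ : ℕ) (ψ : ℕ → ℂ → ℂ) : FockSpace →ₗ.[ℂ] FockSpace where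
  domain := fockSubmodule.comap (fockDiffExpr κ ψ)
  toFun := ((fockDiffExpr κ ψ).comp (Submodule.subtype _)).codRestrict fockSubmodule
    (fun f => f.2)

theorem fockMaxOp_apply (κ : ℕ) (ψ : ℕ → ℂ → ℂ) (f : (fockMaxOp κ ψ).domain) (z : ℂ) :
    fockMaxOp κ ψ f z
      = ∑ p ∈ Finset.range (κ + 1), ψ p z * iteratedDeriv p (f : FockSpace) z := rfl

/-! ### Maximal differential operators on `L²(ℝ)` -/

/-- The Lebesgue space `L²(ℝ)` of complex-valued functions. -/
abbrev L2R : Type := Lp ℂ 2 (volume : Measure ℝ)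

/-- The inclusion of `L²(ℝ)` into the tempered distributions, `φ ↦ ∫ φ(x) f(x) dx`. -/
def distOfL2 : L2R →ₗ[ℂ] 𝓢'(ℝ, ℂ) :=
  (Lp.toTemperedDistributionCLM ℂ (volume : Measure ℝ) 2).toLinearMap

theorem distOfL2_injective : Function.Injective distOfL2 :=
  LinearMap.ker_eq_bot.1 Lp.ker_toTemperedDistributionCLM_eq_bot

/-- The operator `X`, multiplication by `x`, on tempered distributions. -/
def opX : Module.End ℂ 𝓢'(ℝ, ℂ) :=
  (TemperedDistribution.smulLeftCLM ℂ (fun x : ℝ => (x : ℂ))).toLinearMap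

/-- The operator `P = -i d/dx` on tempered distributions. -/
def opP : Module.End ℂ 𝓢'(ℝ, ℂ) :=
  (-Complex.I) • (TemperedDistribution.derivCLM ℂ).toLinearMap

theorem opX_apply (u : 𝓢'(ℝ, ℂ)) (φ : 𝓢(ℝ, ℂ)) :
    opX u φ = u (SchwartzMap.smulLeftCLM ℂ (fun x : ℝ => (x : ℂ)) φ) := rfl

theorem opP_apply (u : 𝓢'(ℝ, ℂ)) (φ : 𝓢(ℝ, ℂ)) :
    opP u φ = Complex.I * u (SchwartzMap.derivCLM ℂ ℂ φ) := by
  simp [opP, TemperedDistribution.derivCLM_apply_apply]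

/-- The expression `∑_{p ≤ κ} ∑_{j ≤ κ} α_{j,p} ((X - iP)/√2)^j ((X + iP)/√2)^p`, with all
derivatives taken in the sense of distributions. -/
def ladderExpr (κ : ℕ) (α : ℕ → ℕ → ℂ) : Module.End ℂ 𝓢'(ℝ, ℂ) :=
  ∑ p ∈ Finset.range (κ + 1), ∑ j ∈ Finset.range (κ + 1),
    α j p • ((((√2 : ℝ) : ℂ)⁻¹ • (opX - Complex.I • opP)) ^ j *
      (((√2 : ℝ) : ℂ)⁻¹ • (opX + Complex.I • opP)) ^ p)

/-- The maximal operator on `L²(ℝ)` induced by an expression `E` acting on distributions: its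
domain consists of all `f` in `L²(ℝ)` such that the distribution `E f` is (given by) an element of
`L²(ℝ)`, and this element is the value at `f`. For expressions with polynomial coefficients,
testing `E f` against Schwartz functions or against compactly supported smooth functions is the
same, since the latter are dense in the former. -/
def l2MaxOp (E : Module.End ℂ 𝓢'(ℝ, ℂ)) : L2R →ₗ.[ℂ] L2R where
  domain := (LinearMap.range distOfL2).comap (E ∘ₗ distOfL2)
  toFun := (LinearEquiv.ofInjective distOfL2 distOfL2_injective).symm.toLinearMap ∘ₗ
    ((E ∘ₗ distOfL2).comp (Submodule.subtype _)).codRestrict (LinearMap.range distOfL2)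
      (fun f => f.2)

theorem distOfL2_l2MaxOp (E : Module.End ℂ 𝓢'(ℝ, ℂ)) (f : (l2MaxOp E).domain) :
    distOfL2 (l2MaxOp E f) = E (distOfL2 f) :=
  congrArg Subtype.val ((LinearEquiv.ofInjective distOfL2 distOfL2_injective).apply_symm_apply
    (⟨E (distOfL2 f), f.2⟩ : LinearMap.range distOfL2))

/-! ### The Segal–Bargmann transform -/

/-- The kernel `A(z, x) = π^{-1/4} exp ((-z² + 2√2 x z - x²) / 2)`. -/
def sbKernel (z : ℂ) (x : ℝ) : ℂ :=
  ((Real.pi ^ (-(1 / 4) : ℝ) : ℝ) : ℂ) *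
    Complex.exp ((-z ^ 2 + 2 * ((√2 : ℝ) : ℂ) * (x : ℂ) * z - (x : ℂ) ^ 2) / 2)

theorem sbKernel_hasDerivAt (z : ℂ) (x : ℝ) :
    HasDerivAt (sbKernel z) ((((√2 : ℝ) : ℂ) * z - x) * sbKernel z x) x := by
  have h : HasDerivAt (fun y : ℂ => ((Real.pi ^ (-(1 / 4) : ℝ) : ℝ) : ℂ) *
      Complex.exp ((-z ^ 2 + 2 * ((√2 : ℝ) : ℂ) * y * z - y ^ 2) / 2))
      (((Real.pi ^ (-(1 / 4) : ℝ) : ℝ) : ℂ) *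
        (Complex.exp ((-z ^ 2 + 2 * ((√2 : ℝ) : ℂ) * (x : ℂ) * z - (x : ℂ) ^ 2) / 2) *
          ((2 * ((√2 : ℝ) : ℂ) * 1 * z - (2 : ℕ) * (x : ℂ) ^ 1 * 1) / 2))) (x : ℂ) := by
    refine HasDerivAt.const_mul _ (HasDerivAt.cexp (HasDerivAt.div_const ?_ 2))
    refine HasDerivAt.sub ?_ ((hasDerivAt_id (x : ℂ)).pow 2)
    exact (((hasDerivAt_id (x : ℂ)).const_mul _).mul_const z).const_add _
  refine h.comp_ofReal.congr_deriv ?_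
  simp only [sbKernel]
  push_cast
  ring

theorem sbKernel_contDiff (z : ℂ) : ContDiff ℝ ∞ (sbKernel z) := by
  unfold sbKernel
  have : ContDiff ℝ ∞ (fun x : ℝ => (x : ℂ)) := Complex.ofRealCLM.contDiff
  fun_prop

theorem sbKernel_iteratedDeriv (z : ℂ) (n : ℕ) :
    ∃ Q : Polynomial ℂ, ∀ x : ℝ, iteratedDeriv n (sbKernel z) x = Q.eval (x : ℂ) * sbKernel z x := by
  induction n with
  | zero => exact ⟨1, fun x => by simp⟩
  | succ n ih =>
    obtain ⟨Q, hQ⟩ := ih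
    refine ⟨Q.derivative + Q * (Polynomial.C (((√2 : ℝ) : ℂ) * z) - Polynomial.X), fun x => ?_⟩
    have hfun : iteratedDeriv n (sbKernel z) = fun y : ℝ => Q.eval (y : ℂ) * sbKernel z y :=
      funext hQ
    rw [iteratedDeriv_succ, hfun]
    refine (((Q.hasDerivAt (x : ℂ)).comp_ofReal).mul (sbKernel_hasDerivAt z x)).deriv.trans ?_
    simp only [Polynomial.eval_add, Polynomial.eval_mul, Polynomial.eval_sub, Polynomial.eval_C,
      Polynomial.eval_X]
    ring

theorem sbKernel_bound (z : ℂ) (m : ℕ) : ∃ C : ℝ, ∀ x : ℝ, |x| ^ m * ‖sbKernel z x‖ ≤ C := by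
  set b : ℝ := √2 * |z.re| + 1 with hb
  refine ⟨m.factorial * (Real.pi ^ (-(1 / 4) : ℝ) *
    Real.exp (-(z ^ 2).re / 2 + b ^ 2 / 2)), fun x => ?_⟩
  have hre : ((-z ^ 2 + 2 * ((√2 : ℝ) : ℂ) * (x : ℂ) * z - (x : ℂ) ^ 2) / 2).re
      = -(z ^ 2).re / 2 + (√2 * z.re * x - x ^ 2 / 2) := by
    have h : (-z ^ 2 + 2 * ((√2 : ℝ) : ℂ) * (x : ℂ) * z - (x : ℂ) ^ 2) / 2
        = ((-(1 / 2) : ℝ) : ℂ) * z ^ 2 + ((√2 * x : ℝ) : ℂ) * z + ((-(x ^ 2 / 2) : ℝ) : ℂ) := by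
      push_cast
      ring
    rw [h, Complex.add_re, Complex.add_re, Complex.re_ofReal_mul, Complex.re_ofReal_mul,
      Complex.ofReal_re]
    ring
  have hnorm : ‖sbKernel z x‖ = Real.pi ^ (-(1 / 4) : ℝ) *
      Real.exp (-(z ^ 2).re / 2 + (√2 * z.re * x - x ^ 2 / 2)) := by
    rw [sbKernel, norm_mul, Complex.norm_exp, hre, Complex.norm_real, Real.norm_of_nonneg]
    positivity
  have hpow : |x| ^ m ≤ m.factorial * Real.exp |x| := by
    have := Real.pow_div_factorial_le_exp |x| (abs_nonneg x) m
    rw [div_le_iff₀ (by positivity)] at this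
    linarith
  have hexp : |x| + (√2 * z.re * x - x ^ 2 / 2) ≤ b ^ 2 / 2 := by
    have h1 : z.re * x ≤ |z.re| * |x| := (le_abs_self _).trans (abs_mul _ _).le
    have h2 : √2 * (z.re * x) ≤ √2 * (|z.re| * |x|) := by gcongr
    have h3 := sq_nonneg (|x| - b)
    have h4 : |x| ^ 2 = x ^ 2 := sq_abs x
    have h5 : b * |x| = √2 * (|z.re| * |x|) + |x| := by rw [hb]; ring
    nlinarith
  calc |x| ^ m * ‖sbKernel z x‖
      ≤ (m.factorial * Real.exp |x|) * ‖sbKernel z x‖ := by gcongr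
    _ = m.factorial * (Real.pi ^ (-(1 / 4) : ℝ) *
        Real.exp (-(z ^ 2).re / 2 + (|x| + (√2 * z.re * x - x ^ 2 / 2)))) := by
        rw [hnorm, show -(z ^ 2).re / 2 + (|x| + (√2 * z.re * x - x ^ 2 / 2))
          = |x| + (-(z ^ 2).re / 2 + (√2 * z.re * x - x ^ 2 / 2)) by ring, Real.exp_add |x|]
        ring
    _ ≤ _ := by gcongr

theorem sbKernel_decay (z : ℂ) (k n : ℕ) :
    ∃ C : ℝ, ∀ x : ℝ, ‖x‖ ^ k * ‖iteratedFDeriv ℝ n (sbKernel z) x‖ ≤ C := by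
  obtain ⟨Q, hQ⟩ := sbKernel_iteratedDeriv z n
  choose C hC using fun m => sbKernel_bound z m
  refine ⟨∑ i ∈ Finset.range (Q.natDegree + 1), ‖Q.coeff i‖ * C (k + i), fun x => ?_⟩
  rw [norm_iteratedFDeriv_eq_norm_iteratedDeriv, hQ, norm_mul, Polynomial.eval_eq_sum_range]
  calc ‖x‖ ^ k * (‖∑ i ∈ Finset.range (Q.natDegree + 1), Q.coeff i * (x : ℂ) ^ i‖ * ‖sbKernel z x‖)
      ≤ ‖x‖ ^ k * ((∑ i ∈ Finset.range (Q.natDegree + 1), ‖Q.coeff i‖ * |x| ^ i) *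
          ‖sbKernel z x‖) := by
        gcongr
        refine (norm_sum_le _ _).trans (le_of_eq ?_)
        simp
    _ = ∑ i ∈ Finset.range (Q.natDegree + 1), ‖Q.coeff i‖ * (|x| ^ (k + i) * ‖sbKernel z x‖) := by
        rw [Finset.sum_mul, Finset.mul_sum]
        refine Finset.sum_congr rfl fun i _ => ?_
        rw [Real.norm_eq_abs, pow_add]
        ring
    _ ≤ _ := by
        gcongr with i _
        exact hC _ x

/-- For fixed `z`, the kernel `A(z, ·)` is a Schwartz function. -/
def sbKernelSchwartz (z : ℂ) : 𝓢(ℝ, ℂ) where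
  toFun := sbKernel z
  smooth' := sbKernel_contDiff z
  decay' := sbKernel_decay z

/-- The Segal–Bargmann transform of a tempered distribution `u`, that is the function
`z ↦ ⟨u, A(z, ·)⟩`. For `u` in `L²(ℝ)` this is `∫ A(z, x) u(x) dx`. -/
def sbTransform (u : 𝓢'(ℝ, ℂ)) (z : ℂ) : ℂ := u (sbKernelSchwartz z)

theorem sbTransform_distOfL2 (f : L2R) (z : ℂ) :
    sbTransform (distOfL2 f) z = ∫ x : ℝ, sbKernel z x * f x :=
  Lp.toTemperedDistribution_apply f (sbKernelSchwartz z)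

/-! ### Unitary equivalence of unbounded operators -/

/-- The operator `U L U⁻¹`, with domain `{f | U⁻¹ f ∈ dom L}`. -/
def conjOp (U : L2R ≃ₗᵢ[ℂ] FockSpace) (L : L2R →ₗ.[ℂ] L2R) : FockSpace →ₗ.[ℂ] FockSpace where
  domain := L.domain.comap U.symm.toLinearEquiv.toLinearMap
  toFun := U.toLinearEquiv.toLinearMap ∘ₗ L.toFun ∘ₗ
    (U.symm.toLinearEquiv.toLinearMap.restrict (fun _ h => h))

theorem conjOp_apply (U : L2R ≃ₗᵢ[ℂ] FockSpace) (L : L2R →ₗ.[ℂ] L2R) (f : (conjOp U L).domain) :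
    conjOp U L f = U (L ⟨U.symm f, f.2⟩) := rfl

end

/-
The coherent states `conj A(a, ·)` in `L²(ℝ)` and the reproducing kernels of the Fock space have the
same Gram matrix and both are total (on the real side this is uniqueness of the Fourier transform),
so there is a unitary operator that exchanges them, and it is `U`. By Parseval's formula `U` turns
the bilinear pairing `∫ f φ` into `⟨F, G⟩ = π⁻¹ ∫ F(w) G(conj w) exp (-|w|²) dV(w)`. This pairing
still makes sense when `G` is the transform of a Schwartz function, which decays faster than every
power of `|w|` relative to `exp (|w|² / 2)`, and `F` grows at most polynomially relative to it; in
this way entire functions `F` represent tempered distributions. Integration by parts in the plane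
shows that `d/dz` and multiplication by `z` are transposes of each other for this pairing, so the
ladder operators act on the representing functions as `z` and `d/dz`. As a distribution and its
representing function determine each other, the maximal operators correspond, domains included.
-/

noncomputable section

open Filter Asymptotics
open scoped ComplexConjugate Topology FourierTransform

/-! ### The Gaussian measure on the complex plane -/

section Gaussian

variable {E : Type*} [NormedAddCommGroup E] [NormedSpace ℝ E]

theorem integrable_fockMeasure_iff {h : ℂ → E} :
    Integrable h fockMeasure ↔
      Integrable fun z => (Real.pi⁻¹ * Real.exp (-‖z‖ ^ 2)) • h z := by
  rw [fockMeasure, integrable_withDensity_iff_integrable_smul' (by fun_prop) (by simp)]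
  refine integrable_congr (.of_forall fun z => ?_)
  simp only
  rw [ENNReal.toReal_ofReal (by positivity)]

theorem integral_fockMeasure (h : ℂ → E) :
    ∫ z, h z ∂fockMeasure = ∫ z, (Real.pi⁻¹ * Real.exp (-‖z‖ ^ 2)) • h z := by
  rw [fockMeasure, integral_withDensity_eq_integral_toReal_smul (by fun_prop) (by simp)]
  refine integral_congr_ae (.of_forall fun z => ?_)
  simp only
  rw [ENNReal.toReal_ofReal (by positivity)]

end Gaussian

instance : IsProbabilityMeasure fockMeasure := by
  have hint : Integrable fun z : ℂ => Real.pi⁻¹ * Real.exp (-‖z‖ ^ 2) := by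
    have := (GaussianFourier.integrable_cexp_neg_mul_sq_norm_add (b := 1) (V := ℂ) (by simp) 0
      0).norm.const_mul Real.pi⁻¹
    simpa [Complex.norm_exp, ← Complex.ofReal_pow] using this
  have hval : ∫ z : ℂ, Real.pi⁻¹ * Real.exp (-‖z‖ ^ 2) = 1 := by
    have := GaussianFourier.integral_rexp_neg_mul_sq_norm (b := 1) (V := ℂ) one_pos
    rw [integral_const_mul]
    simp only [neg_mul, one_mul, div_one, Complex.finrank_real_complex] at this
    simp [this, Real.pi_ne_zero]
  refine ⟨?_⟩
  rw [fockMeasure, withDensity_apply _ .univ, Measure.restrict_univ,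
    ← ofReal_integral_eq_lintegral_ofReal hint (.of_forall fun z => by positivity), hval,
    ENNReal.ofReal_one]

theorem measurePreserving_fockMeasure (e : ℂ ≃ₗᵢ[ℝ] ℂ) :
    MeasurePreserving e fockMeasure fockMeasure := by
  refine ⟨e.continuous.measurable, Measure.ext fun s hs => ?_⟩
  rw [Measure.map_apply e.continuous.measurable hs, fockMeasure, withDensity_apply _ hs,
    withDensity_apply _ (e.continuous.measurable hs),
    ← e.measurePreserving.setLIntegral_comp_preimage hs (by fun_prop)]
  simp only [e.norm_map]

theorem measurePreserving_conj_fockMeasure :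
    MeasurePreserving (conj : ℂ → ℂ) fockMeasure fockMeasure :=
  measurePreserving_fockMeasure Complex.conjLIE

theorem measurableEmbedding_conj : MeasurableEmbedding (conj : ℂ → ℂ) :=
  Complex.conjLIE.toHomeomorph.measurableEmbedding

/-- The mean value property: average over the circles centred at the origin, then over `μ`. -/
theorem integral_eq_of_measurePreserving_rotation {μ : Measure ℂ} [IsProbabilityMeasure μ]
    (hμ : ∀ c : Circle, MeasurePreserving (rotation c) μ μ) {H : ℂ → ℂ} (hH : Differentiable ℂ H)
    (hint : Integrable H μ) : ∫ v, H v ∂μ = H 0 := by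
  have hcont := hH.continuous
  have hemb (θ : ℝ) : MeasurableEmbedding (rotation (Circle.exp θ)) :=
    (rotation (Circle.exp θ)).toHomeomorph.measurableEmbedding
  have hrot (θ : ℝ) : ∫ v, H (rotation (Circle.exp θ) v) ∂μ = ∫ v, H v ∂μ :=
    (hμ _).integral_comp (hemb θ) H
  have hrot_norm (θ : ℝ) : ∫ v, ‖H (rotation (Circle.exp θ) v)‖ ∂μ = ∫ v, ‖H v‖ ∂μ :=
    (hμ _).integral_comp (hemb θ) fun v => ‖H v‖
  have hcircle (v : ℂ) :
      ∫ θ in (0 : ℝ)..2 * Real.pi, H (rotation (Circle.exp θ) v) = (2 * Real.pi) • H 0 := by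
    have hd : Differentiable ℂ fun w => H (w * v) := hH.comp (by fun_prop)
    have := circleAverage_of_differentiable_on_off_countable (f := fun w => H (w * v)) (c := 0)
      (R := 1) Set.countable_empty hd.continuous.continuousOn fun z _ => hd z
    rw [Real.circleAverage_def, zero_mul, inv_smul_eq_iff₀ (by positivity)] at this
    simpa [circleMap] using this
  have hprod : Integrable
      (Function.uncurry fun (θ : ℝ) (v : ℂ) => H (rotation (Circle.exp θ) v))
      ((volume.restrict (Set.uIoc 0 (2 * Real.pi))).prod μ) := by
    refine (integrable_prod_iff ?_).2 ⟨.of_forall fun θ => ?_, ?_⟩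
    · refine Continuous.aestronglyMeasurable ?_
      simp only [Function.uncurry_def, rotation_apply]
      fun_prop
    · exact (hμ (Circle.exp θ)).integrable_comp_of_integrable hint
    · simp only [Function.uncurry_apply_pair, hrot_norm]
      exact intervalIntegrable_iff.1 intervalIntegrable_const
  have hswap := intervalIntegral_integral_swap hprod
  simp only [hrot, hcircle, intervalIntegral.integral_const, integral_const, sub_zero,
    probReal_univ, one_smul] at hswap
  exact smul_right_injective ℂ Real.two_pi_pos.ne' hswap

theorem integral_fockMeasure_eq_apply_zero {H : ℂ → ℂ} (hH : Differentiable ℂ H)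
    (hint : Integrable H fockMeasure) : ∫ v, H v ∂fockMeasure = H 0 :=
  integral_eq_of_measurePreserving_rotation (fun _ => measurePreserving_fockMeasure _) hH hint

theorem integral_mul_exp_conj_fockMeasure {F : ℂ → ℂ} (hF : Differentiable ℂ F) (a : ℂ)
    (hint : Integrable (fun w => F w * Complex.exp (a * conj w)) fockMeasure) :
    ∫ w, F w * Complex.exp (a * conj w) ∂fockMeasure = F a := by
  have hshift (w : ℂ) : (Real.pi⁻¹ * Real.exp (-‖w + a‖ ^ 2)) •
      (F (w + a) * Complex.exp (a * conj (w + a)))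
      = (Real.pi⁻¹ * Real.exp (-‖w‖ ^ 2)) • (F (w + a) * Complex.exp (-(w * conj a))) := by
    have : Complex.exp (-(‖w + a‖ : ℂ) ^ 2) * Complex.exp (a * conj (w + a))
        = Complex.exp (-(‖w‖ : ℂ) ^ 2) * Complex.exp (-(w * conj a)) := by
      rw [← Complex.exp_add, ← Complex.exp_add, ← Complex.mul_conj', ← Complex.mul_conj', map_add]
      congr 1
      ring
    simp only [Complex.real_smul]
    push_cast
    linear_combination ((Real.pi : ℂ)⁻¹ * F (w + a)) * this
  have hint' := (integrable_fockMeasure_iff.1 hint).comp_add_right a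
  simp only [hshift] at hint'
  have hd : Differentiable ℂ fun w => F (w + a) * Complex.exp (-(w * conj a)) :=
    (hF.comp (by fun_prop)).mul (by fun_prop)
  rw [integral_fockMeasure, ← integral_add_right_eq_self _ a]
  simp only [hshift]
  rw [← integral_fockMeasure,
    integral_fockMeasure_eq_apply_zero hd (integrable_fockMeasure_iff.2 hint')]
  simp

/-! ### Reproducing kernels and completeness of the Fock space -/

namespace FockSpace

theorem integrable_mul_conj (f g : FockSpace) :
    Integrable (fun z => g z * conj (f z)) fockMeasure :=
  g.memLp.integrable_mul f.memLp.star

theorem inner_eq_integral_fockMeasure (f g : FockSpace) :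
    inner ℂ f g = ∫ z, g z * conj (f z) ∂fockMeasure := by
  rw [inner_eq_integral, integral_fockMeasure, ← integral_const_mul]
  refine integral_congr_ae (.of_forall fun z => ?_)
  simp only [Complex.real_smul]
  push_cast
  ring

theorem norm_toLp (f : FockSpace) : ‖toLp f‖ = ‖f‖ := rfl

theorem memLp_exp_mul (c : ℂ) : MemLp (fun z : ℂ => Complex.exp (c * z)) 2 fockMeasure := by
  rw [memLp_two_iff_integrable_sq_norm
    (by fun_prop : Continuous fun z : ℂ => Complex.exp (c * z)).aestronglyMeasurable,
    integrable_fockMeasure_iff]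
  have := (GaussianFourier.integrable_cexp_neg_mul_sq_norm_add (b := 1) (V := ℂ) (by simp) 2
    (conj c)).norm.const_mul Real.pi⁻¹
  refine this.congr (.of_forall fun z => ?_)
  have hre : (-1 * (‖z‖ : ℂ) ^ 2 + 2 * (inner ℝ (conj c) z : ℝ)).re
      = -‖z‖ ^ 2 + 2 * (c * z).re := by
    rw [Complex.inner, Complex.conj_conj, mul_comm z]
    simp [← Complex.ofReal_pow]
  simp only [Complex.norm_exp, hre, smul_eq_mul]
  rw [Real.exp_add, two_mul, Real.exp_add]
  ring

/-- The reproducing kernel `z ↦ exp (conj a * z)` of the Fock space at the point `a`. -/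
def kernel (a : ℂ) : FockSpace :=
  ⟨fun z => Complex.exp (conj a * z), by fun_prop, memLp_exp_mul (conj a)⟩

theorem kernel_apply (a z : ℂ) : kernel a z = Complex.exp (conj a * z) := rfl

theorem conj_kernel_apply (a z : ℂ) : conj (kernel a z) = Complex.exp (a * conj z) := by
  rw [kernel_apply, ← Complex.exp_conj, map_mul, Complex.conj_conj]

theorem inner_kernel (a : ℂ) (f : FockSpace) : inner ℂ (kernel a) f = f a := by
  have hint := integrable_mul_conj (kernel a) f
  rw [inner_eq_integral_fockMeasure]
  simp only [conj_kernel_apply] at hint ⊢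
  exact integral_mul_exp_conj_fockMeasure f.differentiable a hint

theorem norm_kernel (a : ℂ) : ‖kernel a‖ = Real.exp (‖a‖ ^ 2 / 2) := by
  rw [norm_eq_sqrt_re_inner (𝕜 := ℂ), inner_kernel, kernel_apply, Complex.conj_mul',
    ← Complex.ofReal_pow, ← Complex.ofReal_exp, RCLike.re_eq_complex_re, Complex.ofReal_re,
    Real.sqrt_eq_iff_mul_self_eq (Real.exp_nonneg _) (Real.exp_nonneg _), ← Real.exp_add,
    add_halves]

theorem norm_apply_le (f : FockSpace) (z : ℂ) : ‖f z‖ ≤ ‖f‖ * Real.exp (‖z‖ ^ 2 / 2) := by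
  rw [← inner_kernel, ← norm_kernel, mul_comm]
  exact norm_inner_le_norm _ _

theorem eq_zero_of_inner_kernel_eq_zero {f : FockSpace} (h : ∀ a, inner ℂ (kernel a) f = 0) :
    f = 0 := by
  refine toFunₗ_injective (funext fun a => ?_)
  rw [← inner_kernel, h, map_zero, Pi.zero_apply]

theorem differentiable_inner_toLp_kernel {f : ℕ → FockSpace} {g : Lp ℂ 2 fockMeasure}
    (hf : Tendsto (fun n => toLp (f n)) atTop (𝓝 g)) :
    Differentiable ℂ fun z => inner ℂ (toLp (kernel z)) g := by
  have hbound (n : ℕ) (z : ℂ) : dist (inner ℂ (toLp (kernel z)) g) (f n z)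
      ≤ Real.exp (‖z‖ ^ 2 / 2) * ‖g - toLp (f n)‖ := by
    rw [← inner_kernel z, dist_eq_norm, ← norm_kernel z, ← norm_toLp]
    change ‖inner ℂ (toLp (kernel z)) g - inner ℂ (toLp (kernel z)) (toLp (f n))‖ ≤ _
    rw [← inner_sub_right]
    exact norm_inner_le_norm _ _
  rw [← differentiableOn_univ]
  refine TendstoLocallyUniformlyOn.differentiableOn (φ := atTop) (F := fun n => f n) ?_
    (.of_forall fun n => (f n).differentiable.differentiableOn) isOpen_univ
  rw [tendstoLocallyUniformlyOn_iff_forall_isCompact isOpen_univ]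
  intro K _ hK
  obtain ⟨R, hR⟩ := hK.isBounded.exists_norm_le
  have hlim : Tendsto (fun n => Real.exp (R ^ 2 / 2) * ‖g - toLp (f n)‖) atTop
      (𝓝 0) := by
    simpa using (hf.const_sub g).norm.const_mul (Real.exp (R ^ 2 / 2))
  rw [Metric.tendstoUniformlyOn_iff]
  intro ε hε
  filter_upwards [hlim.eventually_lt_const hε] with n hn z hz
  refine (hbound n z).trans_lt (lt_of_le_of_lt ?_ hn)
  gcongr
  exact hR z hz

theorem isClosed_range_toLp : IsClosed (Set.range toLp) := by
  refine isSeqClosed_iff_isClosed.1 fun u g hu hg => ?_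
  choose f hf using hu
  obtain rfl : (fun n => toLp (f n)) = u := funext hf
  have hpointwise (z : ℂ) : Tendsto (fun n => f n z) atTop
      (𝓝 (inner ℂ (toLp (kernel z)) g)) := by
    simp only [← inner_kernel z]
    exact (tendsto_const_nhds (x := toLp (kernel z))).inner hg
  have hae : (fun z => inner ℂ (toLp (kernel z)) g) =ᵐ[fockMeasure] g := by
    obtain ⟨ns, hns, hlim⟩ := (tendstoInMeasure_of_tendsto_Lp hg).exists_seq_tendsto_ae
    filter_upwards [hlim, ae_all_iff.2 fun n => (f n).memLp.coeFn_toLp] with z hz hfz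
    refine tendsto_nhds_unique ((hpointwise z).comp hns.tendsto_atTop) (hz.congr fun i => ?_)
    exact hfz (ns i)
  have hmem := (Lp.memLp g).ae_eq hae.symm
  refine ⟨⟨_, differentiable_inner_toLp_kernel hg, hmem⟩, ?_⟩
  exact ((MemLp.toLp_eq_toLp_iff hmem (Lp.memLp g)).2 hae).trans (Lp.toLp_coeFn g (Lp.memLp g))

instance : CompleteSpace FockSpace := by
  have hisom : Isometry toLp := AddMonoidHomClass.isometry_of_norm toLp norm_toLp
  exact (completeSpace_iff_isComplete_range hisom.isUniformInducing).2
    isClosed_range_toLp.isComplete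

end FockSpace

/-! ### Unitary operators determined by Gram matrices -/

section Gram

variable {𝕜 ι E F : Type*} [RCLike 𝕜] [NormedAddCommGroup E] [InnerProductSpace 𝕜 E]
  [NormedAddCommGroup F] [InnerProductSpace 𝕜 F]

theorem denseRange_linearCombination_of_inner_eq_zero [CompleteSpace E] {v : ι → E}
    (hv : ∀ x, (∀ i, inner 𝕜 (v i) x = 0) → x = 0) :
    DenseRange (Finsupp.linearCombination 𝕜 v) := by
  rw [DenseRange, ← LinearMap.coe_range, Finsupp.range_linearCombination,
    Submodule.dense_iff_topologicalClosure_eq_top, Submodule.topologicalClosure_eq_top_iff,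
    Submodule.eq_bot_iff]
  exact fun x hx => hv x fun i => hx (v i) (Submodule.subset_span ⟨i, rfl⟩)

theorem norm_linearCombination_eq_of_inner_eq {v : ι → E} {w : ι → F}
    (h : ∀ i j, inner 𝕜 (w i) (w j) = inner 𝕜 (v i) (v j)) (c : ι →₀ 𝕜) :
    ‖Finsupp.linearCombination 𝕜 w c‖ = ‖Finsupp.linearCombination 𝕜 v c‖ := by
  rw [norm_eq_sqrt_re_inner (𝕜 := 𝕜), norm_eq_sqrt_re_inner (𝕜 := 𝕜)]
  simp only [Finsupp.linearCombination_apply, Finsupp.sum_inner, Finsupp.inner_sum,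
    inner_smul_left, inner_smul_right, h]

/-- The unitary operator that maps a total family `v` to a total family `w` with the same Gram
matrix. -/
def unitaryOfGram [CompleteSpace E] [CompleteSpace F] {v : ι → E} {w : ι → F}
    (hv : ∀ x, (∀ i, inner 𝕜 (v i) x = 0) → x = 0) (hw : ∀ y, (∀ i, inner 𝕜 (w i) y = 0) → y = 0)
    (h : ∀ i j, inner 𝕜 (w i) (w j) = inner 𝕜 (v i) (v j)) : E ≃ₗᵢ[𝕜] F :=
  (LinearEquiv.refl 𝕜 (ι →₀ 𝕜)).extendOfIsometry (Finsupp.linearCombination 𝕜 v)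
    (Finsupp.linearCombination 𝕜 w) (denseRange_linearCombination_of_inner_eq_zero hv)
    (denseRange_linearCombination_of_inner_eq_zero hw) (norm_linearCombination_eq_of_inner_eq h)

theorem unitaryOfGram_apply [CompleteSpace E] [CompleteSpace F] {v : ι → E} {w : ι → F}
    (hv : ∀ x, (∀ i, inner 𝕜 (v i) x = 0) → x = 0) (hw : ∀ y, (∀ i, inner 𝕜 (w i) y = 0) → y = 0)
    (h : ∀ i j, inner 𝕜 (w i) (w j) = inner 𝕜 (v i) (v j)) (i : ι) :
    unitaryOfGram hv hw h (v i) = w i := by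
  have := (LinearEquiv.refl 𝕜 (ι →₀ 𝕜)).extendOfIsometry_eq (Finsupp.linearCombination 𝕜 v)
    (Finsupp.linearCombination 𝕜 w) (denseRange_linearCombination_of_inner_eq_zero hv)
    (denseRange_linearCombination_of_inner_eq_zero hw) (norm_linearCombination_eq_of_inner_eq h)
    (Finsupp.single i 1)
  simpa [unitaryOfGram] using this

end Gram

/-! ### Fourier uniqueness for integrable functions -/

section Fourier

variable {V F : Type*} [NormedAddCommGroup V] [InnerProductSpace ℝ V] [FiniteDimensional ℝ V]
  [MeasurableSpace V] [BorelSpace V] [NormedAddCommGroup F] [NormedSpace ℂ F] [CompleteSpace F]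

theorem integral_fourier_smul_eq_integral_smul_fourier (θ : 𝓢(V, ℂ)) {h : V → F}
    (hh : Integrable h) : ∫ x, (𝓕 θ : 𝓢(V, ℂ)) x • h x = ∫ ξ, θ ξ • 𝓕 h ξ := by
  have := VectorFourier.integral_fourierIntegral_smul_eq_flip (L := innerₗ V)
    Real.continuous_fourierChar continuous_inner (θ.integrable (μ := volume)) hh
  rwa [flip_innerₗ] at this

theorem ae_eq_zero_of_fourier_eq_zero {h : V → F} (hh : Integrable h)
    (h0 : 𝓕 h = 0) : h =ᵐ[volume] 0 := by
  have hmem : MemLp h 1 := memLp_one_iff_integrable.2 hh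
  have hker : hmem.toLp ∈ (Lp.toTemperedDistributionCLM F (volume : Measure V) 1).ker := by
    rw [LinearMap.mem_ker]
    ext φ
    have := integral_fourier_smul_eq_integral_smul_fourier (𝓕⁻ φ) hh
    rw [FourierTransform.fourier_fourierInv_eq, h0] at this
    simp only [Pi.zero_apply, smul_zero, integral_zero] at this
    refine (Lp.toTemperedDistribution_apply _ φ).trans (Eq.trans (integral_congr_ae ?_) this)
    filter_upwards [hmem.coeFn_toLp] with x hx
    rw [hx]
  rw [Lp.ker_toTemperedDistributionCLM_eq_bot, Submodule.mem_bot] at hker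
  exact hmem.coeFn_toLp.symm.trans ((Lp.eq_zero_iff_ae_eq_zero).1 hker)

end Fourier

/-! ### Coherent states and the Segal–Bargmann transform on `L²(ℝ)` -/

theorem ofReal_sqrt_two_sq : ((√2 : ℝ) : ℂ) ^ 2 = 2 := by
  rw [← Complex.ofReal_pow, Real.sq_sqrt zero_le_two, Complex.ofReal_ofNat]

theorem conj_sbKernel (z : ℂ) (x : ℝ) : conj (sbKernel z x) = sbKernel (conj z) x := by
  simp only [sbKernel, map_mul, ← Complex.exp_conj, Complex.conj_ofReal, map_div₀, map_sub,
    map_add, map_neg, map_pow, map_ofNat]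

theorem integral_sbKernel_mul_sbKernel (z w : ℂ) :
    ∫ x : ℝ, sbKernel z x * sbKernel w x = Complex.exp (z * w) := by
  have hmul (x : ℝ) : sbKernel z x * sbKernel w x
      = (((Real.pi ^ (-(1 / 4) : ℝ) : ℝ) : ℂ) * ((Real.pi ^ (-(1 / 4) : ℝ) : ℝ) : ℂ)) *
        Complex.exp (-1 * (x : ℂ) ^ 2 + (((√2 : ℝ) : ℂ) * (z + w)) * x + -(z ^ 2 + w ^ 2) / 2) := by
    rw [sbKernel, sbKernel, mul_mul_mul_comm, ← Complex.exp_add]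
    congr 2
    ring
  have hconst : ((Real.pi ^ (-(1 / 4) : ℝ) : ℝ) : ℂ) * ((Real.pi ^ (-(1 / 4) : ℝ) : ℝ) : ℂ)
      * ((Real.pi : ℂ) / - -1) ^ (1 / 2 : ℂ) = 1 := by
    have hsqrt : ((Real.pi : ℂ) / - -1) ^ (1 / 2 : ℂ) = ((Real.pi ^ (1 / 2 : ℝ) : ℝ) : ℂ) := by
      rw [Complex.ofReal_cpow Real.pi_pos.le]
      norm_num
    rw [hsqrt, ← Complex.ofReal_mul, ← Complex.ofReal_mul, ← Real.rpow_add Real.pi_pos,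
      ← Real.rpow_add Real.pi_pos]
    norm_num
  simp only [hmul]
  rw [integral_const_mul, integral_cexp_quadratic (by simp), ← mul_assoc, hconst, one_mul]
  congr 1
  linear_combination ((z + w) ^ 2 / 4) * ofReal_sqrt_two_sq

/-- The coherent state at `a`: the element of `L²(ℝ)` whose inner product with `f` is the value at
`a` of the Segal–Bargmann transform of `f`. -/
def coherentState (a : ℂ) : L2R := (sbKernelSchwartz (conj a)).toLp 2

theorem coeFn_coherentState (a : ℂ) : coherentState a =ᵐ[volume] sbKernel (conj a) :=
  (sbKernelSchwartz (conj a)).coeFn_toLp 2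

theorem inner_coherentState (a : ℂ) (f : L2R) :
    inner ℂ (coherentState a) f = sbTransform (distOfL2 f) a := by
  rw [L2.inner_def, sbTransform_distOfL2]
  refine integral_congr_ae ?_
  filter_upwards [coeFn_coherentState a] with x hx
  rw [hx, RCLike.inner_apply, conj_sbKernel, Complex.conj_conj, mul_comm]

theorem sbTransform_distOfL2_coherentState (a z : ℂ) :
    sbTransform (distOfL2 (coherentState a)) z = FockSpace.kernel a z := by
  rw [sbTransform_distOfL2, FockSpace.kernel_apply, mul_comm (conj a),
    ← integral_sbKernel_mul_sbKernel]
  refine integral_congr_ae ?_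
  filter_upwards [coeFn_coherentState a] with x hx
  rw [hx]

theorem inner_coherentState_coherentState (a b : ℂ) :
    inner ℂ (coherentState a) (coherentState b)
      = inner ℂ (FockSpace.kernel a) (FockSpace.kernel b) := by
  rw [inner_coherentState, sbTransform_distOfL2_coherentState, FockSpace.inner_kernel]

/-- On the imaginary axis the kernel is, up to a Gaussian factor, the Fourier character times the
ground state `A(0, ·)`. -/
theorem exp_smul_sbKernel_zero (ξ x : ℝ) :
    Complex.exp (((-2 * Real.pi * x * ξ : ℝ) : ℂ) * Complex.I) * sbKernel 0 x
      = Complex.exp (-(Real.pi ^ 2 * ξ ^ 2 : ℝ)) *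
        sbKernel (-((√2 : ℝ) : ℂ) * Real.pi * Complex.I * ξ) x := by
  rw [sbKernel, sbKernel, mul_left_comm, mul_left_comm (Complex.exp _), ← Complex.exp_add,
    ← Complex.exp_add]
  congr 2
  push_cast
  linear_combination (-1 : ℂ) * ((-(Real.pi : ℂ) ^ 2 * ξ ^ 2 * Complex.I ^ 2 / 2
    - Real.pi * x * ξ * Complex.I) * ofReal_sqrt_two_sq
    - (Real.pi : ℂ) ^ 2 * ξ ^ 2 * Complex.I_sq)

theorem fourier_sbKernel_zero_mul (f : L2R) (ξ : ℝ) :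
    𝓕 (fun x : ℝ => sbKernel 0 x * f x) ξ = Complex.exp (-(Real.pi ^ 2 * ξ ^ 2 : ℝ)) *
      sbTransform (distOfL2 f) (-((√2 : ℝ) : ℂ) * Real.pi * Complex.I * ξ) := by
  rw [Real.fourier_real_eq_integral_exp_smul, sbTransform_distOfL2, ← integral_const_mul]
  refine integral_congr_ae (.of_forall fun x => ?_)
  simp only [smul_eq_mul]
  rw [← mul_assoc, exp_smul_sbKernel_zero, mul_assoc]

theorem sbKernel_ne_zero (z : ℂ) (x : ℝ) : sbKernel z x ≠ 0 :=
  mul_ne_zero (Complex.ofReal_ne_zero.2 (Real.rpow_pos_of_pos Real.pi_pos _).ne')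
    (Complex.exp_ne_zero _)

theorem eq_zero_of_inner_coherentState_eq_zero {f : L2R}
    (h : ∀ a, inner ℂ (coherentState a) f = 0) : f = 0 := by
  have hint : Integrable fun x : ℝ => sbKernel 0 x * f x :=
    ((sbKernelSchwartz 0).memLp 2).integrable_mul (Lp.memLp f)
  have hzero := ae_eq_zero_of_fourier_eq_zero hint <| funext fun ξ => by
    rw [fourier_sbKernel_zero_mul, ← inner_coherentState, h, mul_zero, Pi.zero_apply]
  rw [Lp.eq_zero_iff_ae_eq_zero]
  filter_upwards [hzero] with x hx
  exact (mul_eq_zero.1 hx).resolve_left (sbKernel_ne_zero 0 x)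

/-- The Segal–Bargmann transform as a unitary operator from `L²(ℝ)` onto the Fock space: it maps
the coherent state at `a` to the reproducing kernel at `a`. -/
def segalBargmann : L2R ≃ₗᵢ[ℂ] FockSpace :=
  unitaryOfGram (fun _ => eq_zero_of_inner_coherentState_eq_zero)
    (fun _ => FockSpace.eq_zero_of_inner_kernel_eq_zero)
    fun a b => (inner_coherentState_coherentState a b).symm

theorem segalBargmann_coherentState (a : ℂ) :
    segalBargmann (coherentState a) = FockSpace.kernel a :=
  unitaryOfGram_apply ..

theorem segalBargmann_apply (f : L2R) (z : ℂ) :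
    segalBargmann f z = sbTransform (distOfL2 f) z := by
  rw [← FockSpace.inner_kernel, ← segalBargmann_coherentState, LinearIsometryEquiv.inner_map_map,
    inner_coherentState]

theorem toFunₗ_segalBargmann (f : L2R) :
    FockSpace.toFunₗ (segalBargmann f) = sbTransform (distOfL2 f) :=
  funext (segalBargmann_apply f)

/-! ### Growth scale and bilinear pairing of entire functions -/

/-- The scale of weights that measures the growth of entire functions relative to the Gaussian;
every element of the Fock space is dominated by `fockWeight 0`. -/
def fockWeight (s : ℤ) (z : ℂ) : ℝ := (1 + ‖z‖) ^ s * Real.exp (‖z‖ ^ 2 / 2)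

theorem fockWeight_pos (s : ℤ) (z : ℂ) : 0 < fockWeight s z := by
  unfold fockWeight
  positivity

theorem isBigO_fockWeight_iff {s : ℤ} {F : ℂ → ℂ} :
    F =O[⊤] fockWeight s ↔ ∃ C, ∀ z, ‖F z‖ ≤ C * fockWeight s z := by
  simp only [isBigO_top, Real.norm_of_nonneg (fockWeight_pos s _).le]

theorem fockWeight_isBigO_of_le {s t : ℤ} (hst : s ≤ t) : fockWeight s =O[⊤] fockWeight t := by
  refine .of_norm_le fun z => ?_
  rw [Real.norm_of_nonneg (fockWeight_pos s z).le, fockWeight, fockWeight]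
  gcongr
  linarith [norm_nonneg z]

theorem fockWeight_succ (s : ℤ) (z : ℂ) :
    fockWeight (s + 1) z = (1 + ‖z‖) * fockWeight s z := by
  have : 1 + ‖z‖ ≠ 0 := by positivity
  rw [fockWeight, fockWeight, zpow_add_one₀ this]
  ring

theorem isBigO_fockWeight_id_mul {s : ℤ} {F : ℂ → ℂ} (hF : F =O[⊤] fockWeight s) :
    (fun z => z * F z) =O[⊤] fockWeight (s + 1) := by
  obtain ⟨C, hC⟩ := isBigO_fockWeight_iff.1 hF
  refine isBigO_fockWeight_iff.2 ⟨C, fun z => ?_⟩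
  calc ‖z * F z‖ = ‖z‖ * ‖F z‖ := norm_mul _ _
    _ ≤ (1 + ‖z‖) * (C * fockWeight s z) := by
        gcongr
        · linarith
        · exact hC z
    _ = C * fockWeight (s + 1) z := by rw [fockWeight_succ]; ring

theorem isBigO_fockWeight_of_id_mul {s : ℤ} {F : ℂ → ℂ} (hF : F =O[⊤] fockWeight s)
    (hzF : (fun z => z * F z) =O[⊤] fockWeight s) : F =O[⊤] fockWeight (s - 1) := by
  obtain ⟨C, hC⟩ := isBigO_fockWeight_iff.1 hF
  obtain ⟨D, hD⟩ := isBigO_fockWeight_iff.1 hzF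
  refine isBigO_fockWeight_iff.2 ⟨C + D, fun z => ?_⟩
  have hpos : 0 < 1 + ‖z‖ := by positivity
  refine le_of_mul_le_mul_left ?_ hpos
  calc (1 + ‖z‖) * ‖F z‖ = ‖F z‖ + ‖z * F z‖ := by rw [norm_mul]; ring
    _ ≤ C * fockWeight s z + D * fockWeight s z := add_le_add (hC z) (hD z)
    _ = (1 + ‖z‖) * ((C + D) * fockWeight (s - 1) z) := by
        rw [mul_left_comm, ← fockWeight_succ, sub_add_cancel, add_mul]

theorem zpow_le_two_pow_natAbs_mul_zpow {x y : ℝ} (hx : 0 < x) (hy : 0 < y) (hxy : x ≤ 2 * y)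
    (hyx : y ≤ 2 * x) (s : ℤ) : x ^ s ≤ 2 ^ s.natAbs * y ^ s := by
  obtain ⟨n, rfl | rfl⟩ := s.eq_nat_or_neg
  · simp only [zpow_natCast, Int.natAbs_natCast, ← mul_pow]
    gcongr
  · simp only [zpow_neg, zpow_natCast, Int.natAbs_neg, Int.natAbs_natCast]
    rw [← div_eq_mul_inv, inv_le_comm₀ (by positivity) (by positivity), inv_div,
      div_le_iff₀ (by positivity), ← mul_pow]
    gcongr
    linarith

theorem fockWeight_le_of_mem_sphere (s : ℤ) {z w : ℂ}
    (hw : w ∈ Metric.sphere z (1 + ‖z‖)⁻¹) :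
    fockWeight s w ≤ 2 ^ s.natAbs * Real.exp 2 * fockWeight s z := by
  have hpos : 0 < 1 + ‖z‖ := by positivity
  have hr : (1 + ‖z‖)⁻¹ ≤ 1 := inv_le_one_of_one_le₀ (by linarith [norm_nonneg z])
  have hrz : (1 + ‖z‖)⁻¹ * ‖z‖ ≤ 1 := by
    rw [inv_mul_le_iff₀ hpos]
    linarith
  rw [mem_sphere_iff_norm] at hw
  have hwz : ‖w‖ ≤ ‖z‖ + (1 + ‖z‖)⁻¹ := by linarith [norm_le_norm_add_norm_sub' w z]
  have hzw : ‖z‖ ≤ ‖w‖ + (1 + ‖z‖)⁻¹ := by linarith [norm_le_norm_add_norm_sub w z]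
  have hexp : ‖w‖ ^ 2 / 2 ≤ 2 + ‖z‖ ^ 2 / 2 := by
    have := pow_le_pow_left₀ (norm_nonneg w) hwz 2
    nlinarith [inv_pos.2 hpos]
  calc fockWeight s w
      ≤ (2 ^ s.natAbs * (1 + ‖z‖) ^ s) * Real.exp (2 + ‖z‖ ^ 2 / 2) := by
        rw [fockWeight]
        gcongr
        exact zpow_le_two_pow_natAbs_mul_zpow (by positivity) hpos
          (by linarith [norm_nonneg z]) (by linarith [norm_nonneg w]) s
    _ = 2 ^ s.natAbs * Real.exp 2 * fockWeight s z := by rw [Real.exp_add, fockWeight]; ring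

/-- Cauchy's estimate on the circle of radius `1 / (1 + ‖z‖)`, on which the weight is essentially
constant. -/
theorem isBigO_fockWeight_deriv {s : ℤ} {F : ℂ → ℂ} (hd : Differentiable ℂ F)
    (hF : F =O[⊤] fockWeight s) : deriv F =O[⊤] fockWeight (s + 1) := by
  obtain ⟨C, hC⟩ := isBigO_fockWeight_iff.1 hF
  have hC0 : 0 ≤ C := nonneg_of_mul_nonneg_left ((norm_nonneg _).trans (hC 0)) (fockWeight_pos s 0)
  refine isBigO_fockWeight_iff.2 ⟨C * (2 ^ s.natAbs * Real.exp 2), fun z => ?_⟩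
  have hcircle (w : ℂ) (hw : w ∈ Metric.sphere z (1 + ‖z‖)⁻¹) :
      ‖F w‖ ≤ C * (2 ^ s.natAbs * Real.exp 2 * fockWeight s z) :=
    (hC w).trans (mul_le_mul_of_nonneg_left (fockWeight_le_of_mem_sphere s hw) hC0)
  refine (Complex.norm_deriv_le_of_forall_mem_sphere_norm_le (by positivity) hd.diffContOnCl
    hcircle).trans_eq ?_
  rw [div_inv_eq_mul, fockWeight_succ]
  ring

/-- The bilinear pairing of entire functions that corresponds to the pairing `∫ f φ` on the real
line. -/
def fockPairing (F G : ℂ → ℂ) : ℂ := ∫ w, F w * G (conj w) ∂fockMeasure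

theorem integrable_mul_comp_conj {s t : ℤ} {F G : ℂ → ℂ} (hFc : Continuous F) (hGc : Continuous G)
    (hF : F =O[⊤] fockWeight s) (hG : G =O[⊤] fockWeight t) (hst : s + t < -2) :
    Integrable (fun w => F w * G (conj w)) fockMeasure := by
  obtain ⟨C, hC⟩ := isBigO_fockWeight_iff.1 hF
  obtain ⟨D, hD⟩ := isBigO_fockWeight_iff.1 hG
  have hdecay : Integrable fun w : ℂ => (1 + ‖w‖) ^ (s + t) := by
    have hlt : (2 : ℝ) < -((s + t : ℤ) : ℝ) := by exact_mod_cast lt_neg.1 hst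
    have := integrable_one_add_norm (E := ℂ) (μ := volume) (r := -((s + t : ℤ) : ℝ))
      (by rwa [Complex.finrank_real_complex])
    simpa only [neg_neg, Real.rpow_intCast] using this
  refine integrable_fockMeasure_iff.2 ((hdecay.const_mul (Real.pi⁻¹ * C * D)).mono'
    (by fun_prop) (.of_forall fun w => ?_))
  have hpos : 0 < 1 + ‖w‖ := by positivity
  calc ‖(Real.pi⁻¹ * Real.exp (-‖w‖ ^ 2)) • (F w * G (conj w))‖
      = Real.pi⁻¹ * Real.exp (-‖w‖ ^ 2) * (‖F w‖ * ‖G (conj w)‖) := by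
        rw [norm_smul, norm_mul (F w), Real.norm_of_nonneg (by positivity)]
    _ ≤ Real.pi⁻¹ * Real.exp (-‖w‖ ^ 2) *
          ((C * fockWeight s w) * (D * fockWeight t (conj w))) := by
        gcongr
        · exact (norm_nonneg _).trans (hC w)
        · exact hC w
        · exact hD _
    _ = Real.pi⁻¹ * C * D * (Real.exp (-‖w‖ ^ 2 + ‖w‖ ^ 2 / 2 + ‖w‖ ^ 2 / 2) *
          ((1 + ‖w‖) ^ s * (1 + ‖w‖) ^ t)) := by
        rw [fockWeight, fockWeight, Complex.norm_conj, Real.exp_add, Real.exp_add]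
        ring
    _ = Real.pi⁻¹ * C * D * (1 + ‖w‖) ^ (s + t) := by
        rw [zpow_add₀ hpos.ne', add_assoc, add_halves, neg_add_cancel, Real.exp_zero, one_mul]

theorem fockPairing_comm (F G : ℂ → ℂ) : fockPairing F G = fockPairing G F := by
  have := measurePreserving_conj_fockMeasure.integral_comp measurableEmbedding_conj
    fun w => G w * F (conj w)
  simp only [Complex.conj_conj] at this
  rw [fockPairing, fockPairing, ← this]
  simp only [mul_comm]

theorem integral_hasLineDerivAt_eq_zero {E W : Type*} [NormedAddCommGroup E]
    [NormedSpace ℝ E] [FiniteDimensional ℝ E] [MeasurableSpace E] [BorelSpace E] {μ : Measure E}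
    [μ.IsAddHaarMeasure] [NormedAddCommGroup W] [NormedSpace ℝ W]
    {f f' : E → W} {v : E} (hf : ∀ x, HasLineDerivAt ℝ f (f' x) x v) (hfi : Integrable f μ)
    (hf'i : Integrable f' μ) : ∫ x, f' x ∂μ = 0 := by
  have := integral_bilinear_hasLineDerivAt_right_eq_neg_left_of_integrable (μ := μ)
    (B := ContinuousLinearMap.lsmul ℝ ℝ) (f := fun _ : E => (1 : ℝ)) (f' := fun _ => 0) (g := f)
    (g' := f') (v := v) (by simp) (by simpa using hf'i) (by simpa using hfi)
    (fun x _ => by simp [HasLineDerivAt, hasDerivAt_const]) (fun x _ => hf x)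
  simpa using this

theorem integral_fockMeasure_hasLineDerivAt_eq_zero {E : Type*} [NormedAddCommGroup E]
    [NormedSpace ℝ E] {f f' : ℂ → E} {v : ℂ} (hf : ∀ w, HasLineDerivAt ℝ f (f' w) w v)
    (hfi : Integrable f fockMeasure)
    (hf'i : Integrable (fun w => f' w - (2 * inner ℝ w v) • f w) fockMeasure) :
    ∫ w, (f' w - (2 * inner ℝ w v) • f w) ∂fockMeasure = 0 := by
  rw [integral_fockMeasure]
  refine integral_hasLineDerivAt_eq_zero (v := v) (fun w => ?_) (integrable_fockMeasure_iff.1 hfi)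
    (integrable_fockMeasure_iff.1 hf'i)
  have hline : HasDerivAt (fun t : ℝ => w + t • v) v 0 := by
    simpa using ((hasDerivAt_id (0 : ℝ)).smul_const v).const_add w
  refine ((hline.norm_sq.neg.exp.const_mul Real.pi⁻¹).smul (hf w)).congr_deriv ?_
  simp only [zero_smul, add_zero, Pi.neg_apply]
  module

theorem hasLineDerivAt_mul_comp_conj {F G : ℂ → ℂ} (hF : Differentiable ℂ F)
    (hG : Differentiable ℂ G) (w v : ℂ) :
    HasLineDerivAt ℝ (fun w => F w * G (conj w))
      (v * deriv F w * G (conj w) + F w * (conj v * deriv G (conj w))) w v := by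
  have hline : HasDerivAt (fun t : ℝ => w + t • v) v 0 := by
    simpa using ((hasDerivAt_id (0 : ℝ)).smul_const v).const_add w
  have hconj : HasDerivAt (fun t : ℝ => conj (w + t • v)) (conj v) 0 := hline.star
  have hFline := (hF (w + (0 : ℝ) • v)).hasDerivAt.scomp (0 : ℝ) hline
  have hGline := (hG (conj (w + (0 : ℝ) • v))).hasDerivAt.scomp (0 : ℝ) hconj
  refine (hFline.mul hGline).congr_deriv ?_
  simp

theorem ofReal_two_mul_inner (w v : ℂ) :
    ((2 * inner ℝ w v : ℝ) : ℂ) = conj w * v + w * conj v := by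
  rw [Complex.inner, ← Complex.add_conj, map_mul, Complex.conj_conj, mul_comm v, mul_comm (conj v)]

theorem fockPairing_lineDeriv {s t : ℤ} {F G : ℂ → ℂ} (hFd : Differentiable ℂ F)
    (hGd : Differentiable ℂ G) (hF : F =O[⊤] fockWeight s) (hG : G =O[⊤] fockWeight t)
    (hst : s + t < -3) (v : ℂ) :
    v * fockPairing (deriv F) G + conj v * fockPairing F (deriv G)
      = v * fockPairing F (fun z => z * G z) + conj v * fockPairing (fun z => z * F z) G := by
  have hFG := integrable_mul_comp_conj hFd.continuous hGd.continuous hF hG (by lia)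
  have hFG' := (integrable_mul_comp_conj hFd.continuous hGd.deriv.continuous hF
    (isBigO_fockWeight_deriv hGd hG) (by lia)).const_mul (conj v)
  have hF'G := (integrable_mul_comp_conj hFd.deriv.continuous hGd.continuous
    (isBigO_fockWeight_deriv hFd hF) hG (by lia)).const_mul v
  have hFzG := (integrable_mul_comp_conj (G := fun z => z * G z) hFd.continuous
    (continuous_id.mul hGd.continuous) hF (isBigO_fockWeight_id_mul hG) (by lia)).const_mul v
  have hzFG := (integrable_mul_comp_conj (F := fun z => z * F z)
    (continuous_id.mul hFd.continuous) hGd.continuous (isBigO_fockWeight_id_mul hF) hG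
    (by lia)).const_mul (conj v)
  have hsplit (w : ℂ) : v * deriv F w * G (conj w) + F w * (conj v * deriv G (conj w))
      - (2 * inner ℝ w v : ℝ) • (F w * G (conj w))
      = v * (deriv F w * G (conj w)) + conj v * (F w * deriv G (conj w))
        - (v * (F w * (conj w * G (conj w))) + conj v * (w * F w * G (conj w))) := by
    rw [Complex.real_smul, ofReal_two_mul_inner]
    ring
  have hzero := integral_fockMeasure_hasLineDerivAt_eq_zero
    (hasLineDerivAt_mul_comp_conj hFd hGd · v) hFG
    (((hF'G.add hFG').sub (hFzG.add hzFG)).congr (.of_forall fun w => (hsplit w).symm))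
  simp only [hsplit] at hzero
  rw [integral_sub (by exact hF'G.add hFG') (by exact hFzG.add hzFG), integral_add hF'G hFG',
    integral_add hFzG hzFG, sub_eq_zero] at hzero
  simpa only [integral_const_mul, fockPairing] using hzero

/-- Integration by parts for the Wirtinger derivative `(∂₁ - i ∂ᵢ) / 2`, which does not see the
antiholomorphic factor `G (conj w)`. -/
theorem fockPairing_deriv {s t : ℤ} {F G : ℂ → ℂ} (hFd : Differentiable ℂ F)
    (hGd : Differentiable ℂ G) (hF : F =O[⊤] fockWeight s) (hG : G =O[⊤] fockWeight t)
    (hst : s + t < -3) : fockPairing (deriv F) G = fockPairing F fun z => z * G z := by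
  have h1 := fockPairing_lineDeriv hFd hGd hF hG hst 1
  have hI := fockPairing_lineDeriv hFd hGd hF hG hst Complex.I
  rw [map_one] at h1
  rw [Complex.conj_I] at hI
  have hI_ne : (2 * Complex.I : ℂ) ≠ 0 := by simp
  refine mul_left_cancel₀ hI_ne ?_
  linear_combination hI + Complex.I * h1

/-! ### Ladder operators on Schwartz functions and tempered distributions -/

/-- The creation operator `(X - iP)/√2` on tempered distributions. -/
def creationOp : Module.End ℂ 𝓢'(ℝ, ℂ) := ((√2 : ℝ) : ℂ)⁻¹ • (opX - Complex.I • opP)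

/-- The annihilation operator `(X + iP)/√2` on tempered distributions. -/
def annihilationOp : Module.End ℂ 𝓢'(ℝ, ℂ) := ((√2 : ℝ) : ℂ)⁻¹ • (opX + Complex.I • opP)

/-- Multiplication of Schwartz functions by `x`. -/
abbrev mulX : 𝓢(ℝ, ℂ) →L[ℂ] 𝓢(ℝ, ℂ) := SchwartzMap.smulLeftCLM ℂ (fun x : ℝ => (x : ℂ))

/-- The creation operator `(x - d/dx)/√2` on Schwartz functions. -/
def schwartzCreation : 𝓢(ℝ, ℂ) →L[ℂ] 𝓢(ℝ, ℂ) :=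
  ((√2 : ℝ) : ℂ)⁻¹ • (mulX - SchwartzMap.derivCLM ℂ ℂ)

/-- The annihilation operator `(x + d/dx)/√2` on Schwartz functions. -/
def schwartzAnnihilation : 𝓢(ℝ, ℂ) →L[ℂ] 𝓢(ℝ, ℂ) :=
  ((√2 : ℝ) : ℂ)⁻¹ • (mulX + SchwartzMap.derivCLM ℂ ℂ)

theorem mulX_apply (φ : 𝓢(ℝ, ℂ)) (x : ℝ) : mulX φ x = x * φ x :=
  SchwartzMap.smulLeftCLM_apply_apply (by fun_prop) φ x

theorem creationOp_apply (u : 𝓢'(ℝ, ℂ)) (φ : 𝓢(ℝ, ℂ)) :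
    creationOp u φ = u (schwartzAnnihilation φ) := by
  change ((√2 : ℝ) : ℂ)⁻¹ * (opX u φ - Complex.I * opP u φ)
    = u (((√2 : ℝ) : ℂ)⁻¹ • (mulX φ + SchwartzMap.derivCLM ℂ ℂ φ))
  rw [opX_apply, opP_apply, map_smul, map_add, smul_eq_mul]
  linear_combination (-((√2 : ℝ) : ℂ)⁻¹ * u (SchwartzMap.derivCLM ℂ ℂ φ)) * Complex.I_sq

theorem annihilationOp_apply (u : 𝓢'(ℝ, ℂ)) (φ : 𝓢(ℝ, ℂ)) :
    annihilationOp u φ = u (schwartzCreation φ) := by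
  change ((√2 : ℝ) : ℂ)⁻¹ * (opX u φ + Complex.I * opP u φ)
    = u (((√2 : ℝ) : ℂ)⁻¹ • (mulX φ - SchwartzMap.derivCLM ℂ ℂ φ))
  rw [opX_apply, opP_apply, map_smul, map_sub, smul_eq_mul]
  linear_combination (((√2 : ℝ) : ℂ)⁻¹ * u (SchwartzMap.derivCLM ℂ ℂ φ)) * Complex.I_sq

theorem opX_schwartz (φ : 𝓢(ℝ, ℂ)) : opX (φ : 𝓢'(ℝ, ℂ)) = (mulX φ : 𝓢'(ℝ, ℂ)) := by
  ext θ
  rw [opX_apply, SchwartzMap.coe_apply, SchwartzMap.coe_apply]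
  refine integral_congr_ae (.of_forall fun x => ?_)
  simp only [mulX_apply, smul_eq_mul]
  ring

theorem I_smul_opP_schwartz (φ : 𝓢(ℝ, ℂ)) :
    Complex.I • opP (φ : 𝓢'(ℝ, ℂ)) = (SchwartzMap.derivCLM ℂ ℂ φ : 𝓢'(ℝ, ℂ)) := by
  rw [← TemperedDistribution.derivCLM_toTemperedDistributionCLM_eq ℂ, opP, LinearMap.smul_apply,
    smul_smul, mul_neg, Complex.I_mul_I, neg_neg, one_smul]
  rfl

theorem creationOp_schwartz (φ : 𝓢(ℝ, ℂ)) :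
    creationOp (φ : 𝓢'(ℝ, ℂ)) = (schwartzCreation φ : 𝓢'(ℝ, ℂ)) := by
  change ((√2 : ℝ) : ℂ)⁻¹ • (opX (φ : 𝓢'(ℝ, ℂ)) - Complex.I • opP (φ : 𝓢'(ℝ, ℂ))) = _
  rw [opX_schwartz, I_smul_opP_schwartz, ← map_sub, ← map_smul]
  rfl

theorem annihilationOp_schwartz (φ : 𝓢(ℝ, ℂ)) :
    annihilationOp (φ : 𝓢'(ℝ, ℂ)) = (schwartzAnnihilation φ : 𝓢'(ℝ, ℂ)) := by
  change ((√2 : ℝ) : ℂ)⁻¹ • (opX (φ : 𝓢'(ℝ, ℂ)) + Complex.I • opP (φ : 𝓢'(ℝ, ℂ))) = _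
  rw [opX_schwartz, I_smul_opP_schwartz, ← map_add, ← map_smul]
  rfl

theorem schwartzAnnihilation_sbKernelSchwartz (z : ℂ) :
    schwartzAnnihilation (sbKernelSchwartz z) = z • sbKernelSchwartz z := by
  ext x
  have hderiv : SchwartzMap.derivCLM ℂ ℂ (sbKernelSchwartz z) x
      = (((√2 : ℝ) : ℂ) * z - x) * sbKernel z x := (sbKernel_hasDerivAt z x).deriv
  change ((√2 : ℝ) : ℂ)⁻¹ * (mulX (sbKernelSchwartz z) x
    + SchwartzMap.derivCLM ℂ ℂ (sbKernelSchwartz z) x) = z * sbKernel z x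
  rw [mulX_apply, hderiv]
  change ((√2 : ℝ) : ℂ)⁻¹ * (x * sbKernel z x + _) = _
  have hne : ((√2 : ℝ) : ℂ) ≠ 0 := by simp
  field_simp
  ring

theorem sbTransform_creationOp (u : 𝓢'(ℝ, ℂ)) (z : ℂ) :
    sbTransform (creationOp u) z = z * sbTransform u z := by
  rw [sbTransform, creationOp_apply, schwartzAnnihilation_sbKernelSchwartz, map_smul, smul_eq_mul,
    sbTransform]

/-! ### The Segal–Bargmann transform of Schwartz functions -/

theorem distOfL2_toLp (φ : 𝓢(ℝ, ℂ)) : distOfL2 (φ.toLp 2) = (φ : 𝓢'(ℝ, ℂ)) :=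
  Lp.toTemperedDistribution_toLp_eq φ

theorem sbTransform_schwartz (φ : 𝓢(ℝ, ℂ)) :
    sbTransform φ = FockSpace.toFunₗ (segalBargmann (φ.toLp 2)) := by
  rw [toFunₗ_segalBargmann, distOfL2_toLp]

theorem differentiable_sbTransform_schwartz (φ : 𝓢(ℝ, ℂ)) : Differentiable ℂ (sbTransform φ) := by
  rw [sbTransform_schwartz]
  exact FockSpace.differentiable _

theorem sbTransform_sbKernelSchwartz (z w : ℂ) :
    sbTransform (sbKernelSchwartz z) w = Complex.exp (w * z) := by
  rw [sbTransform, SchwartzMap.coe_apply, ← integral_sbKernel_mul_sbKernel]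
  rfl

theorem FockSpace.isBigO_fockWeight (f : FockSpace) : f =O[⊤] fockWeight 0 :=
  isBigO_fockWeight_iff.2 ⟨‖f‖, fun z => by
    rw [fockWeight, zpow_zero, one_mul]
    exact f.norm_apply_le z⟩

/-- Multiplication by `z` corresponds to a ladder operator, hence preserves the growth estimate of
the transforms of all Schwartz functions. -/
theorem isBigO_fockWeight_sbTransform_schwartz (s : ℤ) (φ : 𝓢(ℝ, ℂ)) :
    sbTransform φ =O[⊤] fockWeight s := by
  have hnat (n : ℕ) : ∀ φ : 𝓢(ℝ, ℂ), sbTransform φ =O[⊤] fockWeight (-n) := by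
    induction n with
    | zero =>
      intro φ
      rw [sbTransform_schwartz]
      exact FockSpace.isBigO_fockWeight _
    | succ n ih =>
      intro φ
      have hz : (fun z => z * sbTransform φ z) =O[⊤] fockWeight (-n) := by
        simpa only [← sbTransform_creationOp, creationOp_schwartz] using ih (schwartzCreation φ)
      rw [Nat.cast_succ, neg_add']
      exact isBigO_fockWeight_of_id_mul (ih φ) hz
  exact (hnat s.natAbs φ).trans (fockWeight_isBigO_of_le (by lia))

theorem segalBargmann_star (f : L2R) (z : ℂ) :
    segalBargmann (star f) z = conj (segalBargmann f (conj z)) := by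
  rw [segalBargmann_apply, segalBargmann_apply, sbTransform_distOfL2, sbTransform_distOfL2,
    ← integral_conj]
  refine integral_congr_ae ?_
  filter_upwards [Lp.coeFn_star f] with x hx
  rw [hx, map_mul, conj_sbKernel, Complex.conj_conj]
  rfl

theorem fockPairing_segalBargmann (f g : L2R) :
    fockPairing (segalBargmann f) (segalBargmann g) = ∫ x, g x * f x := by
  calc fockPairing (segalBargmann f) (segalBargmann g)
      = inner ℂ (segalBargmann (star g)) (segalBargmann f) := by
        rw [FockSpace.inner_eq_integral_fockMeasure]
        simp only [segalBargmann_star, Complex.conj_conj, fockPairing]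
    _ = inner ℂ (star g) f := LinearIsometryEquiv.inner_map_map _ _ _
    _ = ∫ x, g x * f x := by
        rw [L2.inner_def]
        refine integral_congr_ae ?_
        filter_upwards [Lp.coeFn_star g] with x hx
        rw [hx, RCLike.inner_apply, mul_comm, Pi.star_apply, RCLike.star_def, Complex.conj_conj]

theorem distOfL2_eq_fockPairing (f : L2R) (φ : 𝓢(ℝ, ℂ)) :
    distOfL2 f φ = fockPairing (segalBargmann f) (sbTransform φ) := by
  rw [sbTransform_schwartz, fockPairing_segalBargmann]
  refine (Lp.toTemperedDistribution_apply f φ).trans (integral_congr_ae ?_)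
  filter_upwards [φ.coeFn_toLp 2] with x hx
  rw [hx, smul_eq_mul]

/-! ### Tempered distributions represented by entire functions -/

/-- The tempered distribution `u` is represented by the entire function `F` of at most polynomial
growth relative to the Gaussian, if pairing `u` with a test function amounts to pairing `F` with
the Segal–Bargmann transform of the test function. -/
structure IsRepresentedBy (u : 𝓢'(ℝ, ℂ)) (F : ℂ → ℂ) : Prop where
  differentiable : Differentiable ℂ F
  isBigO : ∃ s : ℤ, F =O[⊤] fockWeight s
  eq_fockPairing : ∀ φ : 𝓢(ℝ, ℂ), u φ = fockPairing F (sbTransform φ)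

theorem isRepresentedBy_distOfL2 (f : L2R) : IsRepresentedBy (distOfL2 f) (segalBargmann f) where
  differentiable := FockSpace.differentiable _
  isBigO := ⟨0, FockSpace.isBigO_fockWeight _⟩
  eq_fockPairing := distOfL2_eq_fockPairing f

theorem isRepresentedBy_schwartz (φ : 𝓢(ℝ, ℂ)) : IsRepresentedBy φ (sbTransform φ) := by
  rw [sbTransform_schwartz, ← distOfL2_toLp]
  exact isRepresentedBy_distOfL2 _

namespace IsRepresentedBy

variable {u v : 𝓢'(ℝ, ℂ)} {F G : ℂ → ℂ}

theorem unique (hu : IsRepresentedBy u F) (hv : IsRepresentedBy v F) : u = v := by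
  ext φ
  rw [hu.eq_fockPairing, hv.eq_fockPairing]

theorem integrable (hu : IsRepresentedBy u F) (φ : 𝓢(ℝ, ℂ)) :
    Integrable (fun w => F w * sbTransform φ (conj w)) fockMeasure := by
  obtain ⟨s, hs⟩ := hu.isBigO
  exact integrable_mul_comp_conj hu.differentiable.continuous
    (differentiable_sbTransform_schwartz φ).continuous hs
    (isBigO_fockWeight_sbTransform_schwartz (-3 - s) φ) (by lia)

theorem sbTransform_eq (hu : IsRepresentedBy u F) : sbTransform u = F := by
  ext z
  have hint := hu.integrable (sbKernelSchwartz z)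
  rw [sbTransform, hu.eq_fockPairing, fockPairing]
  simp only [sbTransform_sbKernelSchwartz, mul_comm _ z] at hint ⊢
  exact integral_mul_exp_conj_fockMeasure hu.differentiable z hint

theorem annihilationOp (hu : IsRepresentedBy u F) :
    IsRepresentedBy (annihilationOp u) (deriv F) := by
  obtain ⟨s, hs⟩ := hu.isBigO
  refine ⟨hu.differentiable.deriv, ⟨s + 1, isBigO_fockWeight_deriv hu.differentiable hs⟩,
    fun φ => ?_⟩
  rw [annihilationOp_apply, hu.eq_fockPairing, fockPairing_deriv hu.differentiable
    (differentiable_sbTransform_schwartz φ) hs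
    (isBigO_fockWeight_sbTransform_schwartz (-4 - s) φ) (by lia)]
  simp only [← sbTransform_creationOp, creationOp_schwartz]

theorem creationOp (hu : IsRepresentedBy u F) :
    IsRepresentedBy (creationOp u) (fun z => z * F z) := by
  obtain ⟨s, hs⟩ := hu.isBigO
  refine ⟨differentiable_id.mul hu.differentiable, ⟨s + 1, isBigO_fockWeight_id_mul hs⟩,
    fun φ => ?_⟩
  have hderiv : sbTransform (schwartzAnnihilation φ) = deriv (sbTransform φ) := by
    rw [← annihilationOp_schwartz, (isRepresentedBy_schwartz φ).annihilationOp.sbTransform_eq]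
  rw [creationOp_apply, hu.eq_fockPairing, hderiv, fockPairing_comm,
    fockPairing_deriv (differentiable_sbTransform_schwartz φ) hu.differentiable
      (isBigO_fockWeight_sbTransform_schwartz (-4 - s) φ) hs (by lia), fockPairing_comm]

theorem annihilationOp_pow (hu : IsRepresentedBy u F) (p : ℕ) :
    IsRepresentedBy ((_root_.annihilationOp ^ p) u) (iteratedDeriv p F) := by
  induction p with
  | zero => simpa using hu
  | succ p ih =>
    rw [pow_succ', iteratedDeriv_succ]
    exact ih.annihilationOp

theorem creationOp_pow (hu : IsRepresentedBy u F) (j : ℕ) :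
    IsRepresentedBy ((_root_.creationOp ^ j) u) (fun z => z ^ j * F z) := by
  induction j with
  | zero => simpa using hu
  | succ j ih =>
    simp only [pow_succ', mul_assoc]
    exact ih.creationOp

theorem zero : IsRepresentedBy 0 0 where
  differentiable := differentiable_const 0
  isBigO := ⟨0, isBigO_zero _ _⟩
  eq_fockPairing φ := by simp [fockPairing]

theorem add (hu : IsRepresentedBy u F) (hv : IsRepresentedBy v G) :
    IsRepresentedBy (u + v) (F + G) where
  differentiable := hu.differentiable.add hv.differentiable
  isBigO := by
    obtain ⟨s, hs⟩ := hu.isBigO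
    obtain ⟨t, ht⟩ := hv.isBigO
    exact ⟨max s t, (hs.trans (fockWeight_isBigO_of_le (le_max_left s t))).add
      (ht.trans (fockWeight_isBigO_of_le (le_max_right s t)))⟩
  eq_fockPairing φ := by
    change u φ + v φ = _
    simp only [hu.eq_fockPairing, hv.eq_fockPairing, fockPairing, Pi.add_apply, add_mul]
    exact (integral_add (hu.integrable φ) (hv.integrable φ)).symm

theorem smul (c : ℂ) (hu : IsRepresentedBy u F) : IsRepresentedBy (c • u) (c • F) where
  differentiable := hu.differentiable.const_smul c
  isBigO := hu.isBigO.imp fun _ hs => hs.const_smul_left c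
  eq_fockPairing φ := by
    change c * u φ = _
    simp only [hu.eq_fockPairing, fockPairing, Pi.smul_apply, smul_eq_mul, mul_assoc]
    exact (integral_const_mul _ _).symm

theorem sum {ι : Type*} (t : Finset ι) {u : ι → 𝓢'(ℝ, ℂ)} {F : ι → ℂ → ℂ}
    (h : ∀ i, IsRepresentedBy (u i) (F i)) : IsRepresentedBy (∑ i ∈ t, u i) (∑ i ∈ t, F i) := by
  induction t using Finset.cons_induction with
  | empty => simpa using zero
  | cons i t hi ih => simpa only [Finset.sum_cons] using (h i).add ih

theorem ladderExpr (hu : IsRepresentedBy u F) (κ : ℕ) (α : ℕ → ℕ → ℂ) :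
    IsRepresentedBy (ladderExpr κ α u) (∑ p ∈ Finset.range (κ + 1),
      ∑ j ∈ Finset.range (κ + 1), α j p • fun z => z ^ j * iteratedDeriv p F z) := by
  rw [_root_.ladderExpr, LinearMap.sum_apply]
  refine sum _ fun p => ?_
  rw [LinearMap.sum_apply]
  exact sum _ fun j => ((hu.annihilationOp_pow p).creationOp_pow j).smul _

end IsRepresentedBy

/-! ### Unitary equivalence of the maximal operators -/

section UnitaryEquivalence

variable {κ : ℕ} {α : ℕ → ℕ → ℂ} {ψ : ℕ → ℂ → ℂ}

theorem isRepresentedBy_fockDiffExpr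
    (hψ : ∀ p ∈ Finset.range (κ + 1), ∀ z : ℂ,
      ψ p z = ∑ j ∈ Finset.range (κ + 1), α j p * z ^ j) (f : FockSpace) :
    IsRepresentedBy (ladderExpr κ α (distOfL2 (segalBargmann.symm f))) (fockDiffExpr κ ψ f) := by
  have hrep := (isRepresentedBy_distOfL2 (segalBargmann.symm f)).ladderExpr κ α
  rw [LinearIsometryEquiv.apply_symm_apply] at hrep
  convert hrep using 1
  ext z
  simp only [Finset.sum_apply, Pi.smul_apply, smul_eq_mul, ← mul_assoc, ← Finset.sum_mul]
  exact Finset.sum_congr rfl fun p hp => congrArg (· * _) (hψ p hp z)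

theorem ladderExpr_distOfL2_eq_iff
    (hψ : ∀ p ∈ Finset.range (κ + 1), ∀ z : ℂ,
      ψ p z = ∑ j ∈ Finset.range (κ + 1), α j p * z ^ j) (f : FockSpace) (g : L2R) :
    ladderExpr κ α (distOfL2 (segalBargmann.symm f)) = distOfL2 g
      ↔ fockDiffExpr κ ψ f = FockSpace.toFunₗ (segalBargmann g) := by
  have hf := isRepresentedBy_fockDiffExpr hψ f
  constructor <;> intro h
  · rw [← hf.sbTransform_eq, h, toFunₗ_segalBargmann]
  · rw [h] at hf
    exact hf.unique (isRepresentedBy_distOfL2 g)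

theorem fockMaxOp_eq_conjOp
    (hψ : ∀ p ∈ Finset.range (κ + 1), ∀ z : ℂ,
      ψ p z = ∑ j ∈ Finset.range (κ + 1), α j p * z ^ j) :
    fockMaxOp κ ψ = conjOp segalBargmann (l2MaxOp (ladderExpr κ α)) := by
  have hval (f : (fockMaxOp κ ψ).domain) :
      ladderExpr κ α (distOfL2 (segalBargmann.symm f))
        = distOfL2 (segalBargmann.symm (fockMaxOp κ ψ f)) :=
    (ladderExpr_distOfL2_eq_iff hψ f _).2 (by rw [LinearIsometryEquiv.apply_symm_apply]; rfl)
  refine LinearPMap.ext ?_ fun f hf hf' => ?_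
  · ext f
    constructor
    · exact fun hf => ⟨_, (hval ⟨f, hf⟩).symm⟩
    · rintro ⟨g, hg⟩
      change fockDiffExpr κ ψ f ∈ fockSubmodule
      rw [(ladderExpr_distOfL2_eq_iff hψ f g).1 hg.symm]
      exact (segalBargmann g).2
  · rw [conjOp_apply, ← LinearIsometryEquiv.symm_apply_eq]
    apply distOfL2_injective
    rw [distOfL2_l2MaxOp]
    exact (hval ⟨f, hf⟩).symm

end UnitaryEquivalence

end

theorem theorem5p2 :
    ∃ U : L2R ≃ₗᵢ[ℂ] FockSpace,
      (∀ (f : L2R) (z : ℂ), U f z = ∫ x : ℝ, sbKernel z x * f x) ∧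
      ∀ (κ : ℕ) (α : ℕ → ℕ → ℂ) (ψ : ℕ → ℂ → ℂ),
        (∀ p ∈ Finset.range (κ + 1), ∀ z : ℂ,
          ψ p z = ∑ j ∈ Finset.range (κ + 1), α j p * z ^ j) →
        (∀ f : FockSpace,
          fockDiffExpr κ ψ f = sbTransform (ladderExpr κ α (distOfL2 (U.symm f)))) ∧
        fockMaxOp κ ψ = conjOp U (l2MaxOp (ladderExpr κ α)) := by
  refine ⟨segalBargmann, fun f z => ?_, fun κ α ψ hψ => ⟨fun f => ?_, fockMaxOp_eq_conjOp hψ⟩⟩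
  · rw [segalBargmann_apply, sbTransform_distOfL2]
  · exact (isRepresentedBy_fockDiffExpr hψ f).sbTransform_eq.symm
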